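/- Let $\mathbf{Comp}$ be the category of compact Hausdorff spaces (compacta, the empty one included) and continuous maps. A map $f:X\to Y$ is *skeletal* if $f^{-1}(A)$ is nowhere dense in $X$ for every nowhere dense $A\subset Y$, and *irreducible* if $f(X)=Y$ but $f(Z)\neq Y$ for every closed proper subset $Z\subsetneq X$. A commutative square of compacta with top side $\tilde f:\tilde X\to\tilde Y$, bottom side $f:X\to Y$ and vertical sides $p_X:\tilde X\to X$, $p_Y:\tilde Y\to Y$ is *bicommutative* if $\tilde f(p_X^{-1}(x))=p_Y^{-1}(f(x))$ for all $x\in X$. A functor $F:\mathbf{Comp}\to\mathbf{Comp}$ is *1-mec* if 1. $F$ is monomorphic: $Ff$ is injective whenever $f$ is an injective map between compacta; 2. $F$ is epimorphic: $Ff$ is surjective whenever $f$ is a surjective map between compacta; 3. $F$ is continuous: $F$ preserves the limits of inverse spectra, i.e. of inverse systems of compacta and continuous bonding maps indexed by non-empty directed partially ordered sets; 4. $F$ preserves finite 1-preimages: for every bicommutative commutative square as above in which $f$ and $\tilde f$ are injective, $p_X$ is bijective and $X$ is finite, its image under $F$ is bicommutative. **Corollary 6.2.** For every 1-mec functor $F:\mathbf{Comp}\to\mathbf{Comp}$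 and every irreducible continuous map $f:X\to Y$ between compacta, the map $Ff:FX\to FY$ is skeletal. -/

import Mathlib

open CategoryTheory CategoryTheory.Limits

universe u

/-- A map is skeletal if preimages of nowhere dense sets are nowhere dense. -/
def IsSkeletalMap {X Y : Type*} [TopologicalSpace X] [TopologicalSpace Y] (f : X → Y) : Prop :=
  ∀ A : Set Y, IsNowhereDense A → IsNowhereDense (f ⁻¹' A)

/-- A map is irreducible if it is onto, but maps no proper closed subset of its domain onto its
codomain. -/
def IsIrreducibleMap {X Y : Type*} [TopologicalSpace X] [TopologicalSpace Y] (f : X → Y) : Prop :=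
  Set.range f = Set.univ ∧
    ∀ Z : Set X, IsClosed Z → Z ≠ Set.univ → f '' Z ≠ Set.univ

/-- Bicommutativity of a square with top side `f' : X' → Y'`, bottom side `f : X → Y`, left side
`pX : X' → X` and right side `pY : Y' → Y`. -/
def IsBicommutative {X' Y' X Y : Type*} (f' : X' → Y') (pX : X' → X) (pY : Y' → Y)
    (f : X → Y) : Prop :=
  ∀ x : X, f' '' (pX ⁻¹' {x}) = pY ⁻¹' {f x}

namespace CompHausFunctor

/-- `F` preserves injectivity of maps. -/
def IsMonomorphic (F : CompHaus.{u} ⥤ CompHaus.{u}) : Prop :=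
  ∀ ⦃X Y : CompHaus.{u}⦄ (f : X ⟶ Y), Function.Injective f → Function.Injective (F.map f)

/-- `F` preserves surjectivity of maps. -/
def IsEpimorphic (F : CompHaus.{u} ⥤ CompHaus.{u}) : Prop :=
  ∀ ⦃X Y : CompHaus.{u}⦄ (f : X ⟶ Y), Function.Surjective f → Function.Surjective (F.map f)

/-- `F` is continuous: it preserves limits of inverse spectra, that is, of inverse systems
indexed by non-empty directed partially ordered sets. -/
def IsContinuous (F : CompHaus.{u} ⥤ CompHaus.{u}) : Prop :=
  ∀ (J : Type u) [PartialOrder J] [IsDirectedOrder J] [Nonempty J],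
    PreservesLimitsOfShape Jᵒᵖ F

/-- `F` preserves finite 1-preimages: it preserves the bicommutativity of commutative squares
whose horizontal sides are injective, whose left side is bijective and whose lower left corner
is finite. -/
def PreservesFiniteOnePreimages (F : CompHaus.{u} ⥤ CompHaus.{u}) : Prop :=
  ∀ ⦃X' Y' X Y : CompHaus.{u}⦄ (f' : X' ⟶ Y') (pX : X' ⟶ X) (pY : Y' ⟶ Y) (f : X ⟶ Y),
    f' ≫ pY = pX ≫ f → Finite X →
    Function.Injective f → Function.Injective f' → Function.Bijective pX →
    IsBicommutative f' pX pY f →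
    IsBicommutative (F.map f') (F.map pX) (F.map pY) (F.map f)

/-- `F` is mec: monomorphic, epimorphic and continuous. -/
structure IsMec (F : CompHaus.{u} ⥤ CompHaus.{u}) : Prop where
  monomorphic : IsMonomorphic F
  epimorphic : IsEpimorphic F
  continuous : IsContinuous F

/-- `F` is 1-mec: mec and preserving finite 1-preimages. -/
structure IsOneMec (F : CompHaus.{u} ⥤ CompHaus.{u}) : Prop extends IsMec F where
  preservesFiniteOnePreimages : PreservesFiniteOnePreimages F

end CompHausFunctor

section Skeletal

variable {X Y Z : Type*} [TopologicalSpace X] [TopologicalSpace Y] [TopologicalSpace Z]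

/-! It suffices that `F.map f` sends nonempty open sets to sets with nonempty interior. Precomposing
with an irreducible map from a profinite `E` reduces to `X = E`, since `F` preserves surjections.
There, continuity of `F` shrinks an open set to one pulled back from a finite quotient `Q` of `E`.
Irreducibility gives, inside each piece of the quotient, a whole fibre of `f`. Finite 1-preimages
turn this choice of fibres into a whole fibre of `F.map f` inside the open set; as `F.map f` is
closed and onto, the image has interior. -/

theorem isSkeletalMap_of_nonempty_interior_image {f : X → Y} (hf : Continuous f)
    (h : ∀ U : Set X, IsOpen U → U.Nonempty → (interior (f '' U)).Nonempty) :
    IsSkeletalMap f := by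
  intro A hA
  by_contra hne
  obtain ⟨y, hy⟩ := h _ isOpen_interior (Set.nonempty_iff_ne_empty.2 hne)
  have hsub : f '' interior (closure (f ⁻¹' A)) ⊆ closure A :=
    Set.image_subset_iff.2 (interior_subset.trans (hf.closure_preimage_subset A))
  have hy' : y ∈ interior (closure A) := interior_mono hsub hy
  rw [IsNowhereDense] at hA
  simp [hA] at hy'

/-- If the fibre of `f` over some point lies in the open set `U`, then the image of `U` has
nonempty interior. -/
theorem IsClosedMap.nonempty_interior_image_of_preimage_singleton_subset {f : X → Y}
    (hf : IsClosedMap f) (hs : Function.Surjective f) {U : Set X} (hU : IsOpen U) {y : Y}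
    (hy : f ⁻¹' {y} ⊆ U) : (interior (f '' U)).Nonempty := by
  refine ⟨y, mem_interior.2 ⟨(f '' Uᶜ)ᶜ, ?_, (hf _ hU.isClosed_compl).isOpen_compl, ?_⟩⟩
  · intro z hz
    obtain ⟨x, rfl⟩ := hs z
    exact ⟨x, by_contra fun hx => hz ⟨x, hx, rfl⟩, rfl⟩
  · rintro ⟨x, hx, hxy⟩
    exact hx (hy hxy)

theorem IsIrreducibleMap.comp {g : Y → Z} {f : X → Y} (hg : IsIrreducibleMap g)
    (hf : IsIrreducibleMap f) (hfc : IsClosedMap f) : IsIrreducibleMap (g ∘ f) := by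
  refine ⟨by rw [Set.range_comp, hf.1, Set.image_univ, hg.1], fun T hT hne h => ?_⟩
  rw [Set.image_comp] at h
  exact hg.2 _ (hfc T hT) (hf.2 T hT hne) h

theorem IsIrreducibleMap.exists_preimage_singleton_subset {f : X → Y} (hf : IsIrreducibleMap f)
    {U : Set X} (hU : IsOpen U) (hne : U.Nonempty) : ∃ y, f ⁻¹' {y} ⊆ U := by
  have hc : Uᶜ ≠ Set.univ := fun h => hne.ne_empty (Set.compl_univ_iff.1 h)
  obtain ⟨y, hy⟩ := (Set.ne_univ_iff_exists_notMem _).1 (hf.2 _ hU.isClosed_compl hc)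
  exact ⟨y, fun x hx => by_contra fun hxU => hy ⟨x, hxU, hx⟩⟩

end Skeletal

/-- Every compact Hausdorff space is an irreducible image of a profinite space. -/
theorem CompHaus.exists_profinite_isIrreducibleMap (X : CompHaus.{u}) :
    ∃ (E : Profinite.{u}) (p : profiniteToCompHaus.obj E ⟶ X), IsIrreducibleMap p := by
  have hc : Continuous (Ultrafilter.extend (id : X → X)) := continuous_ultrafilter_extend _
  have hs : Function.Surjective (Ultrafilter.extend (id : X → X)) := fun x =>
    ⟨pure x, ultrafilter_extend_pure id x⟩
  have : T1Space X := T2Space.t1Space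
  -- A minimal compact set of ultrafilters mapping onto `X`: minimality is irreducibility.
  obtain ⟨E, hE, himg, hmin⟩ := exists_compact_surjective_zorn_subset hc hs
  refine ⟨Profinite.of E, CompHausLike.ofHom _ ⟨E.domRestrict (Ultrafilter.extend id),
    hc.comp continuous_subtype_val⟩, ?_, fun Z hZ hne => hmin Z hne hZ⟩
  exact (Set.range_domRestrict _ E).trans himg

namespace CompHausFunctor

variable {F : CompHaus.{u} ⥤ CompHaus.{u}}

/-- Sets pulled back from finite discrete quotients of `E` form a basis of the topology
of `F.obj E`. -/
theorem IsContinuous.exists_discreteQuotient_preimage_subset (hF : IsContinuous F)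
    (E : Profinite.{u}) {U : Set (F.obj (profiniteToCompHaus.obj E))} (hU : IsOpen U)
    {a : F.obj (profiniteToCompHaus.obj E)} (ha : a ∈ U) :
    ∃ (S : DiscreteQuotient E) (V : Set (F.obj (profiniteToCompHaus.obj (E.diagram.obj S)))),
      IsOpen V ∧
      F.map (profiniteToCompHaus.map (E.asLimitCone.π.app S)) a ∈ V ∧
      F.map (profiniteToCompHaus.map (E.asLimitCone.π.app S)) ⁻¹' V ⊆ U := by
  have : PreservesLimitsOfShape (DiscreteQuotient E)ᵒᵈᵒᵖ F := hF _
  -- Finer quotients are smaller in this order, so the directed index set is the order dual.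
  have : PreservesLimitsOfShape (DiscreteQuotient E) F :=
    preservesLimitsOfShape_of_equiv
      ((orderDualEquivalence (DiscreteQuotient E)).op.trans
        (opOpEquivalence (DiscreteQuotient E))) F
  have hlim := isLimitOfPreserves (profiniteToCompHaus ⋙ F ⋙ compHausToTop) E.asLimit
  have hB := TopCat.isTopologicalBasis_cofiltered_limit _ _ hlim (fun _ => {V | IsOpen V})
    (fun _ => TopologicalSpace.isTopologicalBasis_opens) (fun _ => isOpen_univ)
    (fun _ _ _ h₁ h₂ => h₁.inter h₂) (fun _ _ f _ hV => hV.preimage (TopCat.Hom.hom _).continuous)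
  obtain ⟨W, ⟨S, V, hV, rfl⟩, haW, hWU⟩ := hB.exists_subset_of_mem_open ha hU
  exact ⟨S, V, hV, haW, hWU⟩

/-- If `f` maps the fibres over the points `i e` into the fibres `p ⁻¹' {e}` of a map to a finite
space, then the same holds after applying `F`. -/
theorem PreservesFiniteOnePreimages.map_eq_of_map_eq (hF : PreservesFiniteOnePreimages F)
    {X Y Q : CompHaus.{u}} [Finite Q] (f : X ⟶ Y) (hf : Function.Surjective f) (p : X ⟶ Q)
    (i : Q ⟶ Y) (hi : ∀ e x, f x = i e → p x = e)
    (a : F.obj Q) (c : F.obj X) (hc : F.map f c = F.map i a) : F.map p c = a := by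
  -- The fibres of `f` need not be points, but in the image `R` of `h` the fibre over `i e` is the
  -- single point `(e, i e)`. So `s` and `i` form a finite 1-preimage square, through which `f` and
  -- `p` factor.
  let h : X → Q × Y := fun x => (p x, f x)
  have hcont : Continuous h :=
    p.hom.hom.continuous.prodMk f.hom.hom.continuous
  have : CompactSpace (Set.range h) := isCompact_iff_compactSpace.1 (isCompact_range hcont)
  have : T1Space Q := T2Space.t1Space
  have : DiscreteTopology Q := Finite.instDiscreteTopology
  have hmem : ∀ e, (e, i e) ∈ Set.range h := fun e => by
    obtain ⟨x, hx⟩ := hf (i e)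
    exact ⟨x, Prod.ext (hi e x hx) hx⟩
  let R : CompHaus.{u} := CompHaus.of (Set.range h)
  let g : X ⟶ R := CompHausLike.ofHom _ ⟨Set.rangeFactorization h, hcont.subtype_mk _⟩
  let q : R ⟶ Q := CompHausLike.ofHom _ ⟨fun z => z.1.1, by fun_prop⟩
  let f' : R ⟶ Y := CompHausLike.ofHom _ ⟨fun z => z.1.2, by fun_prop⟩
  let s : Q ⟶ R := CompHausLike.ofHom _ ⟨fun e => ⟨(e, i e), hmem e⟩, continuous_of_discreteTopology⟩
  have hgq : g ≫ q = p := rfl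
  have hgf : g ≫ f' = f := rfl
  have hsq : s ≫ q = 𝟙 Q := rfl
  have hsf : s ≫ f' = 𝟙 Q ≫ i := rfl
  have hi_inj : Function.Injective i := fun e e' hee => by
    obtain ⟨x, hx⟩ := hf (i e)
    exact (hi e x hx).symm.trans (hi e' x (hx.trans hee))
  have hs_inj : Function.Injective s := fun e e' hee => congrArg q hee
  have hbi : IsBicommutative s (𝟙 Q) f' i := by
    intro e
    ext z
    constructor
    · rintro ⟨e', rfl, rfl⟩
      rfl
    · intro hz
      obtain ⟨⟨e', y⟩, x, hx⟩ := z
      obtain ⟨rfl, rfl⟩ := Prod.ext_iff.1 hx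
      have hz' : f x = i e := hz
      exact ⟨e, rfl, Subtype.ext (Prod.ext (hi e x hz').symm hz'.symm)⟩
  have hFbi := hF s (𝟙 Q) f' i hsf inferInstance hi_inj hs_inj Function.bijective_id hbi a
  have hc' : F.map g c ∈ F.map f' ⁻¹' {F.map i a} := by
    rw [← hc, ← hgf, F.map_comp]
    rfl
  rw [← hFbi] at hc'
  obtain ⟨a', ha', hga⟩ := hc'
  have ha : a' = a := by simpa using ha'
  subst ha
  calc F.map p c = F.map q (F.map g c) := by rw [← hgq, F.map_comp]; rfl
    _ = F.map (s ≫ q) a' := by rw [← hga, F.map_comp]; rfl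
    _ = a' := by rw [hsq, F.map_id]; rfl

theorem IsOneMec.nonempty_interior_image (hF : IsOneMec F) (E : Profinite.{u}) {Y : CompHaus.{u}}
    (f : profiniteToCompHaus.obj E ⟶ Y) (hf : IsIrreducibleMap f)
    {U : Set (F.obj (profiniteToCompHaus.obj E))} (hU : IsOpen U) (hne : U.Nonempty) :
    (interior (F.map f '' U)).Nonempty := by
  obtain ⟨c₀, hc₀⟩ := hne
  obtain ⟨S, V, -, hcV, hVU⟩ := hF.continuous.exists_discreteQuotient_preimage_subset E hU hc₀
  let Q : CompHaus.{u} := profiniteToCompHaus.obj (E.diagram.obj S)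
  let p : profiniteToCompHaus.obj E ⟶ Q := profiniteToCompHaus.map (E.asLimitCone.π.app S)
  have : Finite Q := inferInstanceAs (Finite S)
  have : T1Space Q := T2Space.t1Space
  have : DiscreteTopology Q := Finite.instDiscreteTopology
  have hs : Function.Surjective f := Set.range_eq_univ.1 hf.1
  have hfib : ∀ e : Q, ∃ y : Y, f ⁻¹' {y} ⊆ p ⁻¹' {e} := fun e =>
    hf.exists_preimage_singleton_subset
      ((isOpen_discrete ({e} : Set Q)).preimage p.hom.hom.continuous)
      (S.proj_surjective e)
  choose i hi using hfib
  have hi_cont : Continuous (i : Q → Y) := continuous_of_discreteTopology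
  let j : Q ⟶ Y := CompHausLike.ofHom _ ⟨i, hi_cont⟩
  -- All of the fibre through this point has the same image as `c₀` under `F.map p`, hence lies over
  -- `V`.
  refine (F.map f).hom.hom.continuous.isClosedMap
    |>.nonempty_interior_image_of_preimage_singleton_subset (hF.epimorphic f hs) hU
      (y := F.map j (F.map p c₀)) fun c hc => hVU ?_
  have hpc := hF.preservesFiniteOnePreimages.map_eq_of_map_eq f hs p j
    (fun e x (hx : f x = i e) => hi e hx) _ c hc
  exact (congrArg (· ∈ V) hpc).mpr hcV

end CompHausFunctor

theorem corollary6p2 (F : CompHaus.{u} ⥤ CompHaus.{u}) (hF : CompHausFunctor.IsOneMec F)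
    (X Y : CompHaus.{u}) (f : X ⟶ Y) (hf : IsIrreducibleMap f) :
    IsSkeletalMap (F.map f) := by
  obtain ⟨E, p, hp⟩ := X.exists_profinite_isIrreducibleMap
  have hcomp : IsIrreducibleMap (p ≫ f) := hf.comp hp p.hom.hom.continuous.isClosedMap
  refine isSkeletalMap_of_nonempty_interior_image (F.map f).hom.hom.continuous
    fun U hU ⟨a, ha⟩ => ?_
  obtain ⟨b, rfl⟩ := hF.epimorphic p (Set.range_eq_univ.1 hp.1) a
  refine (hF.nonempty_interior_image E (p ≫ f) hcomp
    (hU.preimage (F.map p).hom.hom.continuous) ⟨b, ha⟩).mono (interior_mono ?_)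
  rintro _ ⟨c, hc, rfl⟩
  exact ⟨F.map p c, hc, by rw [F.map_comp]; rfl⟩
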